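/- **Diagonal linear nets, rich regime.** Let $n\ge 1$, let $x_1,\dots,x_n\in\mathbb R^d$, let $w^*\in\mathbb R^d$, and let $y_i=\operatorname{sign}(\langle w^*,x_i\rangle)\in\{-1,+1\}$ (so $\langle w^*,x_i\rangle\neq 0$ for all $i$). For $\theta=(u,v)\in\mathbb R^d\times\mathbb R^d\simeq\mathbb R^{2d}$ let $f(\theta;x)=\sum_{j=1}^d u_j^2x_j-\sum_{j=1}^d v_j^2x_j=\langle u^{\odot 2}-v^{\odot 2},x\rangle$ be the two-layer diagonal linear net, and for $\lambda>0$ let $$\mathcal L_\lambda(\theta)=\frac1n\sum_{i=1}^n e^{-y_i f(\theta;x_i)}+\frac{\lambda}{2}\|\theta\|_2^2 .$$ Let the weight decay be a function $\lambda=\lambda(\alpha)>0$ of the initialization scale $\alpha>0$ with $\lambda(\alpha)=\Theta(\alpha^{-p})$ as $\alpha\to+\infty$ for some constant $p>0$. Let $\bar\theta_{\mathrm{init}}=(\mathbf 1,\mathbf 1)$, and let $\theta(t;\alpha\bar\theta_{\mathrm{init}})$, $t\ge 0$, be the solution of the gradient flow $\frac{d\theta}{dt}=-\nabla\mathcal L_{\lambda(\alpha)}(\theta)$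 with $\theta(0)=\alpha\bar\theta_{\mathrm{init}}$. Then for every constant $c\in(0,1)$ and every sequence $\alpha_k\ge 1$ with $\alpha_k\to+\infty$ there exist times $t_k$ with $$\frac{1}{\lambda(\alpha_k)}\log\alpha_k\le t_k\le\frac{1+c}{\lambda(\alpha_k)}\log\alpha_k\qquad\text{for all }k,$$ such that every limit point (limit of a subsequence) of the sequence $\dfrac{\theta(t_k;\alpha_k\bar\theta_{\mathrm{init}})}{\|\theta(t_k;\alpha_k\bar\theta_{\mathrm{init}})\|_2}$ equals $\theta^*/\|\theta^*\|_2$ for some nonzero KKT (Karush–Kuhn–Tucker) point $\theta^*=(u^*,v^*)$ of the problem $$\min_{u,v\in\mathbb R^d}\ \|u\|_2^2+\|v\|_2^2\quad\text{s.t.}\quad y_i\langle u^{\odot 2}-v^{\odot 2},x_i\rangle\ge 1\quad\text{for all } i\in\{1,\dots,n\}.$$ -/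

import Mathlib

open Filter Topology Asymptotics

noncomputable section

namespace DiagNet

/-- The parameter space `ℝ^d × ℝ^d ≃ ℝ^{2d}` with the Euclidean norm; a parameter is
`θ = (u, v)`, where `u k = θ (.inl k)` and `v k = θ (.inr k)`. -/
abbrev Param (d : ℕ) : Type := EuclideanSpace ℝ (Fin d ⊕ Fin d)

variable {d n : ℕ}

/-- The component `u` of `θ = (u, v)`. -/
def uPart (θ : Param d) : EuclideanSpace ℝ (Fin d) := WithLp.toLp 2 fun k => θ (Sum.inl k)

/-- The component `v` of `θ = (u, v)`. -/
def vPart (θ : Param d) : EuclideanSpace ℝ (Fin d) := WithLp.toLp 2 fun k => θ (Sum.inr k)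

/-- The two-layer diagonal linear net `f(θ; x) = ∑ₖ uₖ² xₖ - ∑ₖ vₖ² xₖ`. -/
def net (θ : Param d) (x : EuclideanSpace ℝ (Fin d)) : ℝ :=
  ∑ k, uPart θ k ^ 2 * x k - ∑ k, vPart θ k ^ 2 * x k

/-- The effective weight `w(θ) = u^{⊙2} - v^{⊙2}` (entrywise squares). -/
def effWeight (θ : Param d) : EuclideanSpace ℝ (Fin d) :=
  WithLp.toLp 2 fun k => uPart θ k ^ 2 - vPart θ k ^ 2

theorem net_eq_inner (θ : Param d) (x : EuclideanSpace ℝ (Fin d)) :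
    net θ x = inner ℝ (effWeight θ) x := by
  simp [net, effWeight, PiLp.inner_apply, ← Finset.sum_sub_distrib]
  exact Finset.sum_congr rfl fun k _ => by ring

/-- The empirical exponential loss `(1/n) ∑ᵢ exp (-yᵢ f(θ; xᵢ))`. -/
def loss (x : Fin n → EuclideanSpace ℝ (Fin d)) (y : Fin n → ℝ) (θ : Param d) : ℝ :=
  (1 / (n : ℝ)) * ∑ i, Real.exp (-(y i * net θ (x i)))

/-- The loss with weight decay `lam`. -/
def regLoss (x : Fin n → EuclideanSpace ℝ (Fin d)) (y : Fin n → ℝ) (lam : ℝ) (θ : Param d) : ℝ :=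
  loss x y θ + lam / 2 * ‖θ‖ ^ 2

/-- The unscaled initialization `(𝟏, 𝟏)`. -/
def initParam (d : ℕ) : Param d := WithLp.toLp 2 fun _ => 1

/-- `θ` is a solution on `[0, ∞)` of the gradient flow `dθ/dt = -∇F(θ)` with `θ(0) = θ₀`. -/
def IsGradientFlow {E : Type*} [NormedAddCommGroup E] [InnerProductSpace ℝ E] [CompleteSpace E]
    (F : E → ℝ) (θ₀ : E) (θ : ℝ → E) : Prop :=
  θ 0 = θ₀ ∧ ∀ t, 0 ≤ t → HasDerivWithinAt θ (-gradient F (θ t)) (Set.Ici 0) t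

/-- `z` is a Karush–Kuhn–Tucker point of `min g(z)` subject to `h i z ≥ 1` for all `i`
(for differentiable `g` and `h i`): primal feasibility, and multipliers `μ` satisfying dual
feasibility, complementary slackness and stationarity. -/
def IsKKTPoint {E ι : Type*} [NormedAddCommGroup E] [InnerProductSpace ℝ E] [CompleteSpace E]
    [Fintype ι] (g : E → ℝ) (h : ι → E → ℝ) (z : E) : Prop :=
  (∀ i, 1 ≤ h i z) ∧
    ∃ μ : ι → ℝ, (∀ i, 0 ≤ μ i) ∧ (∀ i, μ i * (h i z - 1) = 0) ∧
      gradient g z = ∑ i, μ i • gradient (h i) z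

end DiagNet

end

noncomputable section

namespace DiagNet

/-! Write `K = log (1/λ)`, so that `exp (-K) = λ`. The loss acts on `u` and `v` with opposite
multiplicative rates `±2 * force`, so `u * v` decays exactly as `α² exp (-2λt)`, while `log u - log
v` paired with a separating direction `w` of margin `γ` (`mirrorCorr`, written `Φ` below) grows at
rate at least `4γ * loss`. A crude norm bound and the known product `u * v` give `Φ = O(log α)` at
time `(1 + c/2) log α / λ`. This caps the integral of the loss over a window of length of order `log
α / λ`.

By time `log α / λ` the initialization has shrunk to unit scale, and the potential `‖θ‖² - (2K/γ) Φ`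
is then `O(K log α)`. Its drift over the first half of the window forces a time at which the
regularized loss is `O(λK)` (`exists_loss_le`). Energy dissipation over the second half, together
with `K = O(log α)`, yields a point whose gradient is `O(λ)` (`exists_regGrad_le`).

At such points `‖θ‖²` and all margins are of order `K`, so normalized margins stay away from zero.
The gradient divided by `λ‖θ‖` tends to zero and becomes the stationarity equation in the limit; its
exponential weights are bounded and converge along a subsequence to KKT multipliers
(`exists_isKKTPoint_of_mapClusterPt`). -/

variable {d n : ℕ}

/-! ### Gradients of the network and of the regularized loss. -/

/-- The gradient of `θ ↦ net θ X`. -/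
def netGrad (X : EuclideanSpace ℝ (Fin d)) (θ : Param d) : Param d :=
  WithLp.toLp 2 (Sum.elim (fun k => 2 * X k * θ (Sum.inl k)) fun k => -(2 * X k * θ (Sum.inr k)))

@[simp] theorem netGrad_inl (X : EuclideanSpace ℝ (Fin d)) (θ : Param d) (k : Fin d) :
    netGrad X θ (Sum.inl k) = 2 * X k * θ (Sum.inl k) := rfl

@[simp] theorem netGrad_inr (X : EuclideanSpace ℝ (Fin d)) (θ : Param d) (k : Fin d) :
    netGrad X θ (Sum.inr k) = -(2 * X k * θ (Sum.inr k)) := rfl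

theorem netGrad_smul (X : EuclideanSpace ℝ (Fin d)) (a : ℝ) (θ : Param d) :
    netGrad X (a • θ) = a • netGrad X θ := by
  ext (k | k) <;> simp <;> ring

theorem continuous_netGrad (X : EuclideanSpace ℝ (Fin d)) : Continuous (netGrad X) := by
  refine (PiLp.continuous_toLp 2 _).comp (continuous_pi ?_)
  rintro (k | k) <;> simp only [Sum.elim_inl, Sum.elim_inr] <;> fun_prop

theorem net_eq_sum (θ : Param d) (X : EuclideanSpace ℝ (Fin d)) :
    net θ X = ∑ k, θ (Sum.inl k) ^ 2 * X k - ∑ k, θ (Sum.inr k) ^ 2 * X k := rfl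

theorem net_smul (a : ℝ) (θ : Param d) (X : EuclideanSpace ℝ (Fin d)) :
    net (a • θ) X = a ^ 2 * net θ X := by
  simp only [net_eq_sum, PiLp.smul_apply, smul_eq_mul, mul_sub, Finset.mul_sum]
  congr 1 <;> exact Finset.sum_congr rfl fun k _ => by ring

theorem continuous_net (X : EuclideanSpace ℝ (Fin d)) : Continuous fun θ : Param d => net θ X := by
  simp only [net_eq_sum]
  fun_prop

theorem inner_netGrad_self (X : EuclideanSpace ℝ (Fin d)) (θ : Param d) :
    inner ℝ (netGrad X θ) θ = 2 * net θ X := by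
  simp only [PiLp.inner_apply, Fintype.sum_sum_type, netGrad_inl, netGrad_inr, net_eq_sum,
    RCLike.inner_apply, conj_trivial]
  rw [mul_sub, Finset.mul_sum, Finset.mul_sum, sub_eq_add_neg, ← Finset.sum_neg_distrib]
  congr 1 <;> exact Finset.sum_congr rfl fun k _ => by ring

theorem norm_sq_eq_sum (θ : Param d) :
    ‖θ‖ ^ 2 = ∑ k, θ (Sum.inl k) ^ 2 + ∑ k, θ (Sum.inr k) ^ 2 := by
  simp [EuclideanSpace.norm_sq_eq, Fintype.sum_sum_type]

theorem abs_net_le (θ : Param d) (X : EuclideanSpace ℝ (Fin d)) :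
    |net θ X| ≤ ‖X‖ * ‖θ‖ ^ 2 := by
  have hX : ∀ k, |X k| ≤ ‖X‖ := fun k => PiLp.norm_apply_le X k
  have key : ∀ f : Fin d → ℝ, |∑ k, f k ^ 2 * X k| ≤ ‖X‖ * ∑ k, f k ^ 2 := fun f => by
    rw [Finset.mul_sum]
    refine (Finset.abs_sum_le_sum_abs _ _).trans (Finset.sum_le_sum fun k _ => ?_)
    rw [abs_mul, abs_of_nonneg (sq_nonneg _), mul_comm]
    exact mul_le_mul_of_nonneg_right (hX k) (sq_nonneg _)
  rw [norm_sq_eq_sum, net_eq_sum, mul_add]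
  exact (abs_sub _ _).trans (add_le_add (key _) (key _))

theorem hasGradientAt_net (X : EuclideanSpace ℝ (Fin d)) (θ : Param d) :
    HasGradientAt (fun ϑ : Param d => net ϑ X) (netGrad X θ) θ := by
  have hc : ∀ s : Fin d ⊕ Fin d, HasFDerivAt (fun ϑ : Param d => ϑ s)
      (EuclideanSpace.proj s : Param d →L[ℝ] ℝ) θ := fun s =>
    (EuclideanSpace.proj s : Param d →L[ℝ] ℝ).hasFDerivAt
  have h := (HasFDerivAt.fun_sum (u := Finset.univ) fun k _ =>
      ((hc (Sum.inl k)).pow 2).mul_const (X k)).sub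
    (HasFDerivAt.fun_sum (u := Finset.univ) fun k _ => ((hc (Sum.inr k)).pow 2).mul_const (X k))
  rw [hasGradientAt_iff_hasFDerivAt]
  refine h.congr_fderiv ?_
  ext ϑ
  simp only [InnerProductSpace.toDual_apply_apply, PiLp.inner_apply, Fintype.sum_sum_type,
    netGrad_inl, netGrad_inr, RCLike.inner_apply, conj_trivial]
  rw [sub_apply, sum_apply, sum_apply, sub_eq_add_neg, ← Finset.sum_neg_distrib]
  congr 1 <;> exact Finset.sum_congr rfl fun k _ => by simp; ring

theorem hasGradientAt_margin (X : EuclideanSpace ℝ (Fin d)) (a : ℝ) (θ : Param d) :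
    HasGradientAt (fun ϑ : Param d => a * inner ℝ (effWeight ϑ) X) (a • netGrad X θ) θ := by
  simp only [← net_eq_inner]
  have h := (hasGradientAt_net X θ).hasFDerivAt.const_mul a
  rw [hasGradientAt_iff_hasFDerivAt, map_smul]
  exact h

theorem hasGradientAt_norm_sq {E : Type*} [NormedAddCommGroup E] [InnerProductSpace ℝ E]
    [CompleteSpace E] (θ : E) : HasGradientAt (fun ϑ : E => ‖ϑ‖ ^ 2) ((2 : ℝ) • θ) θ := by
  rw [hasGradientAt_iff_hasFDerivAt]
  refine (hasStrictFDerivAt_norm_sq θ).hasFDerivAt.congr_fderiv ?_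
  ext ϑ
  simp [two_smul]

theorem norm_uPart_sq_add_norm_vPart_sq (θ : Param d) :
    ‖uPart θ‖ ^ 2 + ‖vPart θ‖ ^ 2 = ‖θ‖ ^ 2 := by
  simp [EuclideanSpace.norm_sq_eq, uPart, vPart]

/-- The gradient of the regularized loss. -/
def regGrad (x : Fin n → EuclideanSpace ℝ (Fin d)) (y : Fin n → ℝ) (lam : ℝ) (θ : Param d) :
    Param d :=
  lam • θ - ∑ i, ((1 / (n : ℝ)) * Real.exp (-(y i * net θ (x i)))) • y i • netGrad (x i) θ

theorem hasGradientAt_regLoss (x : Fin n → EuclideanSpace ℝ (Fin d)) (y : Fin n → ℝ) (lam : ℝ)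
    (θ : Param d) : HasGradientAt (regLoss x y lam) (regGrad x y lam θ) θ := by
  have h1 := (HasFDerivAt.fun_sum (u := Finset.univ) fun i _ =>
    ((hasGradientAt_net (x i) θ).hasFDerivAt.const_mul (y i)).neg.exp).const_mul (1 / (n : ℝ))
  have h2 := (hasGradientAt_norm_sq θ).hasFDerivAt.const_mul (lam / 2)
  rw [hasGradientAt_iff_hasFDerivAt]
  refine (h1.add h2).congr_fderiv ?_
  ext ϑ
  simp [regGrad, Finset.mul_sum, InnerProductSpace.toDual_apply_apply]
  rw [add_comm, ← sub_eq_add_neg]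
  congr 1
  · ring
  · exact Finset.sum_congr rfl fun i _ => by ring

/-- The derivative of the loss with respect to the effective weight, up to sign. -/
def force (x : Fin n → EuclideanSpace ℝ (Fin d)) (y : Fin n → ℝ) (θ : Param d) (k : Fin d) : ℝ :=
  ∑ i, (1 / (n : ℝ)) * Real.exp (-(y i * net θ (x i))) * (y i * x i k)

theorem regGrad_inl (x : Fin n → EuclideanSpace ℝ (Fin d)) (y : Fin n → ℝ) (lam : ℝ)
    (θ : Param d) (k : Fin d) :
    regGrad x y lam θ (Sum.inl k) = -((2 * force x y θ k - lam) * θ (Sum.inl k)) := by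
  simp only [regGrad, PiLp.sub_apply, PiLp.smul_apply, WithLp.ofLp_sum, Finset.sum_apply,
    netGrad_inl, smul_eq_mul, force, Finset.mul_sum, sub_mul, Finset.sum_mul]
  rw [neg_sub]
  congr 1
  exact Finset.sum_congr rfl fun i _ => by ring

theorem regGrad_inr (x : Fin n → EuclideanSpace ℝ (Fin d)) (y : Fin n → ℝ) (lam : ℝ)
    (θ : Param d) (k : Fin d) :
    regGrad x y lam θ (Sum.inr k) = -((-(2 * force x y θ k) - lam) * θ (Sum.inr k)) := by
  simp only [regGrad, PiLp.sub_apply, PiLp.smul_apply, WithLp.ofLp_sum, Finset.sum_apply,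
    netGrad_inr, smul_eq_mul, force, Finset.mul_sum, sub_mul, Finset.sum_mul,
    ← Finset.sum_neg_distrib]
  rw [neg_sub]
  congr 1
  exact Finset.sum_congr rfl fun i _ => by ring

/-! ### Inequalities between loss, margins and force. -/

/-- The average of `qᵢ exp (-qᵢ)` over the margins `qᵢ`. -/
def marginLoss (x : Fin n → EuclideanSpace ℝ (Fin d)) (y : Fin n → ℝ) (θ : Param d) : ℝ :=
  ∑ i, (1 / (n : ℝ)) * Real.exp (-(y i * net θ (x i))) * (y i * net θ (x i))

theorem inner_regGrad_self (x : Fin n → EuclideanSpace ℝ (Fin d)) (y : Fin n → ℝ) (lam : ℝ)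
    (θ : Param d) :
    inner ℝ (regGrad x y lam θ) θ = lam * ‖θ‖ ^ 2 - 2 * marginLoss x y θ := by
  simp only [regGrad, inner_sub_left, sum_inner, inner_smul_left, inner_netGrad_self, marginLoss,
    real_inner_self_eq_norm_sq, conj_trivial, Finset.mul_sum]
  congr 1
  exact Finset.sum_congr rfl fun i _ => by ring

theorem sum_one_div_natCast (hn : 0 < n) : ∑ _i : Fin n, (1 / (n : ℝ)) = 1 := by
  have : (n : ℝ) ≠ 0 := by positivity
  simp [this]

theorem marginLoss_le_one (hn : 0 < n) (x : Fin n → EuclideanSpace ℝ (Fin d)) (y : Fin n → ℝ)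
    (θ : Param d) : marginLoss x y θ ≤ 1 := by
  rw [← sum_one_div_natCast hn]
  refine Finset.sum_le_sum fun i _ => ?_
  set q := y i * net θ (x i)
  rw [mul_assoc]
  refine mul_le_of_le_one_right (by positivity) ?_
  rw [Real.exp_neg, inv_mul_le_iff₀ (Real.exp_pos _)]
  linarith [Real.add_one_le_exp q]

/-- Below `K` the factor `q` is replaced by `K`; above it, `q exp (-q)` is decreasing because `K ≥
1`. With `exp (-K) = λ` this bounds the norm growth by `K * (loss + λ)`. -/
theorem exp_neg_mul_le {K : ℝ} (hK : 1 ≤ K) (q : ℝ) :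
    Real.exp (-q) * q ≤ K * (Real.exp (-q) + Real.exp (-K)) := by
  rcases le_total q K with h | h
  · have h1 := mul_le_mul_of_nonneg_left h (Real.exp_pos (-q)).le
    have h2 : 0 < K * Real.exp (-K) := by positivity
    linarith
  · have h1 : Real.exp (-q) * q ≤ K * Real.exp (-K) := by
      have e1 : Real.exp (-q) = Real.exp (-K) * Real.exp (-(q - K)) := by
        rw [← Real.exp_add]; ring_nf
      have e2 : Real.exp (-(q - K)) * q ≤ K := by
        rw [Real.exp_neg, inv_mul_le_iff₀ (Real.exp_pos _)]
        nlinarith [Real.add_one_le_exp (q - K)]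
      rw [e1, mul_assoc, mul_comm K]
      exact mul_le_mul_of_nonneg_left e2 (Real.exp_pos _).le
    have h2 : 0 < K * Real.exp (-q) := by positivity
    linarith

theorem loss_eq_sum (x : Fin n → EuclideanSpace ℝ (Fin d)) (y : Fin n → ℝ) (θ : Param d) :
    loss x y θ = ∑ i, (1 / (n : ℝ)) * Real.exp (-(y i * net θ (x i))) := by
  rw [loss, Finset.mul_sum]

theorem loss_nonneg (x : Fin n → EuclideanSpace ℝ (Fin d)) (y : Fin n → ℝ) (θ : Param d) :
    0 ≤ loss x y θ := by
  rw [loss_eq_sum]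
  positivity

theorem marginLoss_le (hn : 0 < n) (x : Fin n → EuclideanSpace ℝ (Fin d)) (y : Fin n → ℝ)
    (θ : Param d) {K : ℝ} (hK : 1 ≤ K) :
    marginLoss x y θ ≤ K * (loss x y θ + Real.exp (-K)) := by
  have h : K * (loss x y θ + Real.exp (-K)) = ∑ i, (1 / (n : ℝ)) *
      (K * (Real.exp (-(y i * net θ (x i))) + Real.exp (-K))) := by
    have h1 : K * (loss x y θ + Real.exp (-K)) =
        K * loss x y θ + (∑ _i : Fin n, (1 / (n : ℝ))) * (K * Real.exp (-K)) := by
      rw [sum_one_div_natCast hn]; ring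
    rw [h1, loss_eq_sum, Finset.sum_mul, Finset.mul_sum, ← Finset.sum_add_distrib]
    exact Finset.sum_congr rfl fun i _ => by ring
  rw [h]
  refine Finset.sum_le_sum fun i _ => ?_
  rw [mul_assoc]
  exact mul_le_mul_of_nonneg_left (exp_neg_mul_le hK _) (by positivity)

/-- Separability enters the dynamics only here: the sum on the right is a quarter of the growth rate
of `mirrorCorr`. -/
theorem le_sum_mul_force (x : Fin n → EuclideanSpace ℝ (Fin d)) (y : Fin n → ℝ)
    (θ : Param d) {γ : ℝ} {w : EuclideanSpace ℝ (Fin d)}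
    (hγ : ∀ i, γ ≤ y i * inner ℝ w (x i)) :
    γ * loss x y θ ≤ ∑ k, w k * force x y θ k := by
  have h : ∑ k, w k * force x y θ k = ∑ i, (1 / (n : ℝ)) * Real.exp (-(y i * net θ (x i))) *
      (y i * inner ℝ w (x i)) := by
    simp only [force, PiLp.inner_apply, Finset.mul_sum, RCLike.inner_apply, conj_trivial]
    rw [Finset.sum_comm]
    exact Finset.sum_congr rfl fun i _ => Finset.sum_congr rfl fun k _ => by ring
  rw [h, loss_eq_sum, Finset.mul_sum]
  refine Finset.sum_le_sum fun i _ => ?_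
  rw [mul_comm γ]
  exact mul_le_mul_of_nonneg_left (hγ i) (by positivity)

theorem sub_le_mul_sub_of_hasDerivWithinAt {f f' : ℝ → ℝ}
    (hf : ∀ t, 0 ≤ t → HasDerivWithinAt f (f' t) (Set.Ici 0) t) {a b C : ℝ} (ha : 0 ≤ a)
    (hab : a ≤ b) (hC : ∀ t, a < t → t < b → f' t ≤ C) : f b - f a ≤ C * (b - a) := by
  have hd : ∀ t ∈ interior (Set.Icc a b), HasDerivAt f (f' t) t := fun t ht => by
    rw [interior_Icc] at ht
    have h0 : 0 < t := ha.trans_lt ht.1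
    exact (hf t h0.le).hasDerivAt (Ici_mem_nhds h0)
  refine (convex_Icc a b).image_sub_le_mul_sub_of_deriv_le (fun t ht => ?_)
    (fun t ht => (hd t ht).differentiableAt.differentiableWithinAt) (fun t ht => ?_) a
    (Set.left_mem_Icc.2 hab) b (Set.right_mem_Icc.2 hab) hab
  · exact (hf t (ha.trans ht.1)).continuousWithinAt.mono fun s hs => ha.trans hs.1
  · rw [(hd t ht).deriv]
    rw [interior_Icc] at ht
    exact hC t ht.1 ht.2

/-! ### Exact identities and a priori bounds along the flow. -/

section Flow

variable {x : Fin n → EuclideanSpace ℝ (Fin d)} {y : Fin n → ℝ} {lam α : ℝ} {θ : ℝ → Param d}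

theorem IsGradientFlow.hasDerivWithinAt
    (hθ : IsGradientFlow (regLoss x y lam) (α • initParam d) θ) {t : ℝ} (ht : 0 ≤ t) :
    HasDerivWithinAt θ (-regGrad x y lam (θ t)) (Set.Ici 0) t := by
  rw [← (hasGradientAt_regLoss x y lam (θ t)).gradient]
  exact hθ.2 t ht

theorem IsGradientFlow.hasDerivWithinAt_apply
    (hθ : IsGradientFlow (regLoss x y lam) (α • initParam d) θ) {t : ℝ} (ht : 0 ≤ t)
    (s : Fin d ⊕ Fin d) :
    HasDerivWithinAt (fun t => θ t s) (-regGrad x y lam (θ t) s) (Set.Ici 0) t :=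
  (EuclideanSpace.proj s : Param d →L[ℝ] ℝ).hasFDerivAt.comp_hasDerivWithinAt t
    (hθ.hasDerivWithinAt ht)

theorem IsGradientFlow.hasDerivWithinAt_inl
    (hθ : IsGradientFlow (regLoss x y lam) (α • initParam d) θ) {t : ℝ} (ht : 0 ≤ t) (k : Fin d) :
    HasDerivWithinAt (fun t => θ t (Sum.inl k))
      ((2 * force x y (θ t) k - lam) * θ t (Sum.inl k)) (Set.Ici 0) t := by
  simpa only [regGrad_inl, neg_neg] using hθ.hasDerivWithinAt_apply ht (Sum.inl k)

theorem IsGradientFlow.hasDerivWithinAt_inr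
    (hθ : IsGradientFlow (regLoss x y lam) (α • initParam d) θ) {t : ℝ} (ht : 0 ≤ t) (k : Fin d) :
    HasDerivWithinAt (fun t => θ t (Sum.inr k))
      ((-(2 * force x y (θ t) k) - lam) * θ t (Sum.inr k)) (Set.Ici 0) t := by
  simpa only [regGrad_inr, neg_neg] using hθ.hasDerivWithinAt_apply ht (Sum.inr k)

theorem hasDerivWithinAt_exp_mul (a t : ℝ) (s : Set ℝ) :
    HasDerivWithinAt (fun t => Real.exp (a * t)) (a * Real.exp (a * t)) s t := by
  have := ((hasDerivAt_id t).const_mul a).exp.hasDerivWithinAt (s := s)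
  simpa [mul_comm] using this

theorem IsGradientFlow.zero_apply
    (hθ : IsGradientFlow (regLoss x y lam) (α • initParam d) θ) (s : Fin d ⊕ Fin d) :
    θ 0 s = α := by
  simp [hθ.1, initParam]

/-- The product of paired coordinates is not affected by the loss. -/
theorem IsGradientFlow.mul_eq
    (hθ : IsGradientFlow (regLoss x y lam) (α • initParam d) θ) {t : ℝ} (ht : 0 ≤ t) (k : Fin d) :
    θ t (Sum.inl k) * θ t (Sum.inr k) * Real.exp (2 * lam * t) = α ^ 2 := by
  have hd : ∀ t, 0 ≤ t → HasDerivWithinAt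
      (fun t => θ t (Sum.inl k) * θ t (Sum.inr k) * Real.exp (2 * lam * t)) 0 (Set.Ici 0) t := by
    intro t ht
    refine (((hθ.hasDerivWithinAt_inl ht k).mul (hθ.hasDerivWithinAt_inr ht k)).mul
      (hasDerivWithinAt_exp_mul (2 * lam) t _)).congr_deriv ?_
    simp only [Pi.mul_apply]
    ring
  have h1 := sub_le_mul_sub_of_hasDerivWithinAt hd le_rfl ht (C := 0) fun _ _ _ => le_rfl
  have h2 := sub_le_mul_sub_of_hasDerivWithinAt (fun t ht => (hd t ht).neg) le_rfl ht (C := 0)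
    fun _ _ _ => by simp
  simp only [hθ.zero_apply, Pi.neg_apply, mul_zero, Real.exp_zero] at h1 h2
  linarith

/-- A coordinate reaching zero would annihilate the product that `mul_eq` keeps positive. Positivity
makes the logarithms in `mirrorCorr` differentiable. -/
theorem IsGradientFlow.pos (hα : 0 < α)
    (hθ : IsGradientFlow (regLoss x y lam) (α • initParam d) θ) {t : ℝ} (ht : 0 ≤ t)
    (s : Fin d ⊕ Fin d) : 0 < θ t s := by
  by_contra! hneg
  have hc : ContinuousOn (fun t => θ t s) (Set.Icc 0 t) := fun r hr =>
    (hθ.hasDerivWithinAt_apply hr.1 s).continuousWithinAt.mono fun q hq => hq.1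
  obtain ⟨r, hr, h0⟩ := intermediate_value_Icc' ht hc
    (show (0 : ℝ) ∈ Set.Icc (θ t s) (θ 0 s) from ⟨hneg, by rw [hθ.zero_apply]; exact hα.le⟩)
  have h0 : θ r s = 0 := h0
  have : 0 < α ^ 2 := by positivity
  rcases s with k | k
  · have := hθ.mul_eq hr.1 k
    rw [h0] at this
    linarith
  · have := hθ.mul_eq hr.1 k
    rw [h0] at this
    linarith

theorem IsGradientFlow.hasDerivWithinAt_regLoss
    (hθ : IsGradientFlow (regLoss x y lam) (α • initParam d) θ) {t : ℝ} (ht : 0 ≤ t) :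
    HasDerivWithinAt (fun t => regLoss x y lam (θ t)) (-‖regGrad x y lam (θ t)‖ ^ 2)
      (Set.Ici 0) t := by
  refine ((hasGradientAt_regLoss x y lam (θ t)).hasFDerivAt.comp_hasDerivWithinAt t
    (hθ.hasDerivWithinAt ht)).congr_deriv ?_
  rw [InnerProductSpace.toDual_apply_apply, inner_neg_right, real_inner_self_eq_norm_sq]

theorem IsGradientFlow.hasDerivWithinAt_norm_sq
    (hθ : IsGradientFlow (regLoss x y lam) (α • initParam d) θ) {t : ℝ} (ht : 0 ≤ t) :
    HasDerivWithinAt (fun t => ‖θ t‖ ^ 2)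
      (-(2 * lam) * ‖θ t‖ ^ 2 + 4 * marginLoss x y (θ t)) (Set.Ici 0) t := by
  refine ((hasGradientAt_norm_sq (θ t)).hasFDerivAt.comp_hasDerivWithinAt t
    (hθ.hasDerivWithinAt ht)).congr_deriv ?_
  rw [InnerProductSpace.toDual_apply_apply, inner_neg_right, inner_smul_left, real_inner_comm,
    inner_regGrad_self, conj_trivial]
  ring

/-- The mirror coordinates `log u - log v`, paired with a reference direction. -/
def mirrorCorr (w : EuclideanSpace ℝ (Fin d)) (θ : Param d) : ℝ :=
  ∑ k, w k * (Real.log (θ (Sum.inl k)) - Real.log (θ (Sum.inr k)))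

theorem IsGradientFlow.hasDerivWithinAt_mirrorCorr (hα : 0 < α)
    (hθ : IsGradientFlow (regLoss x y lam) (α • initParam d) θ) (w : EuclideanSpace ℝ (Fin d))
    {t : ℝ} (ht : 0 ≤ t) :
    HasDerivWithinAt (fun t => mirrorCorr w (θ t)) (4 * ∑ k, w k * force x y (θ t) k)
      (Set.Ici 0) t := by
  refine (HasDerivWithinAt.fun_sum (u := Finset.univ) fun k _ =>
    (((hθ.hasDerivWithinAt_inl ht k).log (hθ.pos hα ht _).ne').sub
      ((hθ.hasDerivWithinAt_inr ht k).log (hθ.pos hα ht _).ne')).const_mul (w k)).congr_deriv ?_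
  rw [Finset.mul_sum]
  refine Finset.sum_congr rfl fun k _ => ?_
  rw [mul_div_cancel_right₀ _ (hθ.pos hα ht _).ne', mul_div_cancel_right₀ _ (hθ.pos hα ht _).ne']
  ring

theorem IsGradientFlow.mirrorCorr_zero
    (hθ : IsGradientFlow (regLoss x y lam) (α • initParam d) θ) (w : EuclideanSpace ℝ (Fin d)) :
    mirrorCorr w (θ 0) = 0 := by
  simp [mirrorCorr, hθ.zero_apply]

theorem IsGradientFlow.norm_sq_zero
    (hθ : IsGradientFlow (regLoss x y lam) (α • initParam d) θ) :
    ‖θ 0‖ ^ 2 = 2 * d * α ^ 2 := by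
  simp only [norm_sq_eq_sum, hθ.zero_apply, Finset.sum_const, Finset.card_univ, Fintype.card_fin,
    nsmul_eq_mul]
  ring

/-- Grönwall from `q exp (-q) ≤ 1`. The bound `2 / λ` is far from the true order `K`, but only its
logarithm is used. -/
theorem IsGradientFlow.norm_sq_le (hn : 0 < n) (hlam : 0 < lam)
    (hθ : IsGradientFlow (regLoss x y lam) (α • initParam d) θ) {t : ℝ} (ht : 0 ≤ t) :
    ‖θ t‖ ^ 2 ≤ 2 * d * α ^ 2 * Real.exp (-(2 * lam * t)) + 2 / lam := by
  have h := sub_le_mul_sub_of_hasDerivWithinAt (fun t ht =>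
    ((hθ.hasDerivWithinAt_norm_sq ht).sub_const (2 / lam)).mul
      (hasDerivWithinAt_exp_mul (2 * lam) t _)) le_rfl ht (C := 0) fun r _ _ => by
    have e : (-(2 * lam) * ‖θ r‖ ^ 2 + 4 * marginLoss x y (θ r)) * Real.exp (2 * lam * r) +
        (‖θ r‖ ^ 2 - 2 / lam) * (2 * lam * Real.exp (2 * lam * r)) =
        4 * (marginLoss x y (θ r) - 1) * Real.exp (2 * lam * r) := by
      field_simp
      ring
    rw [e]
    refine mul_nonpos_of_nonpos_of_nonneg ?_ (Real.exp_pos _).le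
    linarith [marginLoss_le_one hn x y (θ r)]
  simp only [Pi.mul_apply, mul_zero, Real.exp_zero, hθ.norm_sq_zero, zero_mul] at h
  have h3 : 0 < 2 / lam := by positivity
  have h2 : (‖θ t‖ ^ 2 - 2 / lam) * Real.exp (2 * lam * t) ≤ 2 * d * α ^ 2 := by linarith
  rw [← le_div_iff₀ (Real.exp_pos _)] at h2
  rw [Real.exp_neg, ← div_eq_mul_inv]
  linarith

/-- Since `log u + log v = 2 log α - 2λt`, an upper bound on both logarithms also bounds their
difference in absolute value. -/
theorem IsGradientFlow.mirrorCorr_le (hα : 0 < α)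
    (hθ : IsGradientFlow (regLoss x y lam) (α • initParam d) θ) (w : EuclideanSpace ℝ (Fin d))
    {t B : ℝ} (ht : 0 ≤ t) (hB : ‖θ t‖ ^ 2 ≤ Real.exp B) :
    mirrorCorr w (θ t) ≤ (∑ k, |w k|) * (B + 2 * lam * t - 2 * Real.log α) := by
  rw [mirrorCorr, Finset.sum_mul]
  refine Finset.sum_le_sum fun k _ => ?_
  refine (le_abs_self _).trans ?_
  rw [abs_mul]
  refine mul_le_mul_of_nonneg_left ?_ (abs_nonneg _)
  have hu := hθ.pos hα ht (Sum.inl k)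
  have hv := hθ.pos hα ht (Sum.inr k)
  have hprod := congrArg Real.log (hθ.mul_eq ht k)
  rw [Real.log_mul (mul_pos hu hv).ne' (Real.exp_pos _).ne', Real.log_mul hu.ne' hv.ne',
    Real.log_exp, Real.log_pow] at hprod
  have hle : ∀ s, 0 < θ t s → 2 * Real.log (θ t s) ≤ B := fun s hs => by
    have h1 : θ t s ^ 2 ≤ Real.exp B := by
      refine le_trans ?_ hB
      rw [EuclideanSpace.norm_sq_eq]
      have := Finset.single_le_sum (f := fun s => ‖θ t s‖ ^ 2) (fun s _ => by positivity)
        (Finset.mem_univ s)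
      simpa using this
    have h2 := Real.log_le_log (by positivity) h1
    rwa [Real.log_exp, Real.log_pow] at h2
  have h1 := hle _ hu
  have h2 := hle _ hv
  push_cast at hprod
  rw [abs_le]
  constructor <;> linarith

theorem IsGradientFlow.mirrorCorr_nonneg (hα : 0 < α)
    (hθ : IsGradientFlow (regLoss x y lam) (α • initParam d) θ) {w : EuclideanSpace ℝ (Fin d)}
    {γ : ℝ} (hγ0 : 0 < γ) (hγ : ∀ i, γ ≤ y i * inner ℝ w (x i)) {t : ℝ} (ht : 0 ≤ t) :
    0 ≤ mirrorCorr w (θ t) := by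
  have h := sub_le_mul_sub_of_hasDerivWithinAt
    (fun t ht => (hθ.hasDerivWithinAt_mirrorCorr hα w ht).neg) le_rfl ht (C := 0) fun r _ _ => by
      have := le_sum_mul_force x y (θ r) hγ
      have := mul_nonneg hγ0.le (loss_nonneg x y (θ r))
      linarith
  simp only [Pi.neg_apply, hθ.mirrorCorr_zero] at h
  linarith

/-- When the initialization has decayed to unit scale, the norm is controlled by the growth of
the mirror coordinates. -/
theorem IsGradientFlow.norm_sq_le_mirrorCorr (hn : 0 < n) (hα : 1 ≤ α) (hlam : 0 < lam)
    (hθ : IsGradientFlow (regLoss x y lam) (α • initParam d) θ) {w : EuclideanSpace ℝ (Fin d)}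
    {γ : ℝ} (hγ0 : 0 < γ) (hγ : ∀ i, γ ≤ y i * inner ℝ w (x i)) {K : ℝ} (hK : 1 ≤ K)
    (hKlam : Real.exp (-K) = lam) {T : ℝ} (hT : lam * T = Real.log α) :
    ‖θ T‖ ^ 2 ≤ 2 * d + K / γ * mirrorCorr w (θ T) + 4 * K * Real.log α := by
  have hα0 : 0 < α := by linarith
  have hT0 : 0 ≤ T := by
    by_contra! h
    nlinarith [Real.log_nonneg hα]
  -- The integrating factor `exp (2λ(t - T))` removes the decay term and is at most one on `[0, T]`.
  -- Subtracting `(K/γ) Φ` cancels the loss contribution `4K * loss`, leaving drift at most `4Kλ`.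
  have h := sub_le_mul_sub_of_hasDerivWithinAt (fun t ht =>
    (((hθ.hasDerivWithinAt_norm_sq ht).mul
      (hasDerivWithinAt_exp_mul (2 * lam) t _)).mul_const (Real.exp (-(2 * lam * T)))).sub
      ((hθ.hasDerivWithinAt_mirrorCorr hα0 w ht).const_mul (K / γ))) le_rfl hT0
      (C := 4 * K * lam) fun r hr0 hrT => by
    have e : ((-(2 * lam) * ‖θ r‖ ^ 2 + 4 * marginLoss x y (θ r)) * Real.exp (2 * lam * r) +
        ‖θ r‖ ^ 2 * (2 * lam * Real.exp (2 * lam * r))) * Real.exp (-(2 * lam * T)) =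
        4 * (marginLoss x y (θ r)) * (Real.exp (2 * lam * r) * Real.exp (-(2 * lam * T))) := by
      ring
    rw [e]
    have h1 : Real.exp (2 * lam * r) * Real.exp (-(2 * lam * T)) ≤ 1 := by
      rw [← Real.exp_add, Real.exp_le_one_iff]
      nlinarith
    have h2 := marginLoss_le hn x y (θ r) hK
    rw [hKlam] at h2
    have h3 : 0 ≤ K * (loss x y (θ r) + lam) :=
      mul_nonneg (by linarith) (add_nonneg (loss_nonneg x y _) hlam.le)
    have h4 : marginLoss x y (θ r) * (Real.exp (2 * lam * r) * Real.exp (-(2 * lam * T))) ≤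
        K * (loss x y (θ r) + lam) :=
      (mul_le_mul_of_nonneg_right h2 (by positivity)).trans (mul_le_of_le_one_right h3 h1)
    have h5 := mul_le_mul_of_nonneg_left (le_sum_mul_force x y (θ r) hγ)
      (show 0 ≤ K / γ by positivity)
    have h6 : K / γ * (γ * loss x y (θ r)) = K * loss x y (θ r) := by
      field_simp
    linarith
  simp only [Pi.sub_apply, Pi.mul_apply, hθ.mirrorCorr_zero, mul_zero, Real.exp_zero,
    hθ.norm_sq_zero] at h
  have e1 : Real.exp (2 * lam * T) * Real.exp (-(2 * lam * T)) = 1 := by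
    rw [← Real.exp_add]; simp
  have e2 : α ^ 2 * Real.exp (-(2 * lam * T)) = 1 := by
    rw [mul_assoc, hT, ← Real.log_rpow hα0, Real.exp_neg, Real.exp_log (by positivity)]
    norm_cast
    exact mul_inv_cancel₀ (by positivity)
  have e3 : ‖θ T‖ ^ 2 * Real.exp (2 * lam * T) * Real.exp (-(2 * lam * T)) = ‖θ T‖ ^ 2 := by
    rw [mul_assoc, e1, mul_one]
  have e4 : 2 * d * α ^ 2 * 1 * Real.exp (-(2 * lam * T)) = 2 * d := by
    rw [mul_one, mul_assoc, e2, mul_one]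
  have e5 : 4 * K * lam * (T - 0) = 4 * K * Real.log α := by rw [← hT]; ring
  rw [e3, e4, e5] at h
  linarith

end Flow

/-! ### Existence of good times in the window. -/

section Flow

variable {x : Fin n → EuclideanSpace ℝ (Fin d)} {y : Fin n → ℝ} {lam α : ℝ} {θ : ℝ → Param d}

theorem IsGradientFlow.mirrorCorr_le_mul_log (hn : 0 < n) (hlam : 0 < lam)
    (hθ : IsGradientFlow (regLoss x y lam) (α • initParam d) θ) (w : EuclideanSpace ℝ (Fin d))
    {K b c : ℝ} (hK : 1 ≤ K) (hKlam : Real.exp (-K) = lam) (hα : 0 < α) (hl : 1 ≤ Real.log α)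
    (hKb : K ≤ b * Real.log α) (hc0 : 0 < c) (hc1 : c < 1) {t : ℝ}
    (ht : lam * t = (1 + c / 2) * Real.log α) :
    mirrorCorr w (θ t) ≤ (∑ k, |w k|) * (Real.log (2 * d + 2) + b + 1) * Real.log α := by
  set l := Real.log α with hl_def
  have ht0 : 0 ≤ t := by
    by_contra! h
    nlinarith
  have hd : (0 : ℝ) < 2 * d + 2 := by positivity
  have hlogd : 0 ≤ Real.log (2 * d + 2) :=
    Real.log_nonneg (by linarith [(Nat.cast_nonneg d : (0 : ℝ) ≤ d)])
  have hcrude : ‖θ t‖ ^ 2 ≤ Real.exp (Real.log (2 * d + 2) + K) := by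
    refine (hθ.norm_sq_le hn hlam ht0).trans ?_
    have e1 : α ^ 2 * Real.exp (-(2 * lam * t)) ≤ 1 := by
      have : α ^ 2 = Real.exp (2 * l) := by
        rw [two_mul, Real.exp_add, Real.exp_log hα, sq]
      rw [this, ← Real.exp_add, Real.exp_le_one_iff, mul_assoc 2 lam t, ht]
      nlinarith
    have e2 : 2 / lam = 2 * Real.exp K := by
      rw [← hKlam, Real.exp_neg, div_inv_eq_mul]
    have e3 : 1 ≤ Real.exp K := Real.one_le_exp (by linarith)
    rw [Real.exp_add, Real.exp_log hd, e2, mul_assoc]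
    have hd' : (0 : ℝ) ≤ 2 * d := by positivity
    nlinarith [mul_le_mul_of_nonneg_left e1 hd', mul_le_mul_of_nonneg_left e3 hd']
  refine (hθ.mirrorCorr_le hα w ht0 hcrude).trans ?_
  rw [mul_assoc (∑ k, |w k|)]
  refine mul_le_mul_of_nonneg_left ?_ (Finset.sum_nonneg fun k _ => abs_nonneg _)
  rw [mul_assoc 2 lam t, ht, ← hl_def]
  nlinarith

/-- A constant bounding the drift of the potential `‖θ‖² - (2 K / γ) mirrorCorr`. -/
def driftConst (d : ℕ) (W γ b : ℝ) : ℝ :=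
  2 * d + 4 + 2 / γ * (W * (Real.log (2 * d + 2) + b + 1))

theorem IsGradientFlow.exists_loss_le (hn : 0 < n) (hlam : 0 < lam)
    (hθ : IsGradientFlow (regLoss x y lam) (α • initParam d) θ) {w : EuclideanSpace ℝ (Fin d)}
    {γ : ℝ} (hγ0 : 0 < γ) (hγ : ∀ i, γ ≤ y i * inner ℝ w (x i))
    {K b c C : ℝ} (hK : 1 ≤ K) (hKlam : Real.exp (-K) = lam) (hα : 1 ≤ α)
    (hl : 1 ≤ Real.log α) (hKb : K ≤ b * Real.log α) (hc0 : 0 < c) (hc1 : c < 1)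
    (hC : driftConst d (∑ k, |w k|) γ b < (C - 2) * c) :
    ∃ t, Real.log α / lam ≤ t ∧ t ≤ (1 + c / 2) * Real.log α / lam ∧
      lam * ‖θ t‖ ^ 2 + 2 * K * loss x y (θ t) ≤ C * lam * K := by
  set l := Real.log α with hl_def
  by_contra! hcon
  have hα0 : 0 < α := by linarith
  set T1 := l / lam with hT1
  set Tm := (1 + c / 2) * l / lam with hTm
  have h1 : lam * T1 = l := by rw [hT1]; field_simp
  have hm : lam * Tm = (1 + c / 2) * l := by rw [hTm]; field_simp
  have hT10 : 0 ≤ T1 := by positivity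
  have hT1m : T1 ≤ Tm := by
    rw [hT1, hTm]
    gcongr
    nlinarith
  -- The coefficient `2K/γ` is twice what cancels the loss: the drift is at most `-2(λ‖θ‖² + 2K *
  -- loss) + 4Kλ`. If no time is good, the potential falls by at least `(C - 2) c K log α`, more
  -- than `driftConst` allows.
  have h := sub_le_mul_sub_of_hasDerivWithinAt (fun t ht =>
    (hθ.hasDerivWithinAt_norm_sq ht).sub
      ((hθ.hasDerivWithinAt_mirrorCorr hα0 w ht).const_mul (2 * K / γ))) hT10 hT1m
      (C := -(2 * (C - 2) * lam * K)) fun r hr1 hrm => by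
    have h2 := marginLoss_le hn x y (θ r) hK
    rw [hKlam] at h2
    have h5 := mul_le_mul_of_nonneg_left (le_sum_mul_force x y (θ r) hγ)
      (show 0 ≤ 2 * K / γ by positivity)
    have h6 : 2 * K / γ * (γ * loss x y (θ r)) = 2 * K * loss x y (θ r) := by
      field_simp
    have h7 := hcon r hr1.le hrm.le
    linarith
  have hN1 := hθ.norm_sq_le_mirrorCorr hn hα hlam hγ0 hγ hK hKlam h1
  have hφ1 := hθ.mirrorCorr_nonneg hα0 hγ0 hγ hT10
  have hφm := hθ.mirrorCorr_le_mul_log hn hlam w hK hKlam hα0 hl hKb hc0 hc1 hm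
  simp only [Pi.sub_apply] at h
  have e1 : -(2 * (C - 2) * lam * K) * (Tm - T1) = -((C - 2) * c * (K * l)) := by
    have : lam * (Tm - T1) = c / 2 * l := by rw [mul_sub, h1, hm]; ring
    calc _ = -(2 * (C - 2) * K * (lam * (Tm - T1))) := by ring
      _ = _ := by rw [this]; ring
  rw [e1] at h
  have hKl : 1 ≤ K * l := one_le_mul_of_one_le_of_one_le hK hl
  have e2 : 0 ≤ K / γ * mirrorCorr w (θ T1) := by positivity
  have e3 : 2 * K / γ * mirrorCorr w (θ T1) = 2 * (K / γ * mirrorCorr w (θ T1)) := by ring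
  have e4 := mul_le_mul_of_nonneg_left hφm (show 0 ≤ 2 * K / γ by positivity)
  have e5 : 2 * K / γ * ((∑ k, |w k|) * (Real.log (2 * d + 2) + b + 1) * l) =
      2 / γ * ((∑ k, |w k|) * (Real.log (2 * d + 2) + b + 1)) * (K * l) := by ring
  have e6 : (2 * d : ℝ) ≤ 2 * d * (K * l) := le_mul_of_one_le_right (by positivity) hKl
  have e7 := mul_lt_mul_of_pos_right hC (show 0 < K * l by linarith)
  rw [driftConst] at e7
  have e8 : 0 ≤ ‖θ Tm‖ ^ 2 := by positivity
  rw [e5] at e4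
  rw [e3] at h
  linarith

/-- In the second part of the time window, the flow passes through an approximately stationary
point at which the regularized loss is of order `lam * log (1 / lam)`. -/
theorem IsGradientFlow.exists_regGrad_le (hn : 0 < n) (hlam : 0 < lam)
    (hθ : IsGradientFlow (regLoss x y lam) (α • initParam d) θ) {w : EuclideanSpace ℝ (Fin d)}
    {γ : ℝ} (hγ0 : 0 < γ) (hγ : ∀ i, γ ≤ y i * inner ℝ w (x i))
    {K b c C : ℝ} (hK : 1 ≤ K) (hKlam : Real.exp (-K) = lam) (hα : 1 ≤ α)
    (hl : 1 ≤ Real.log α) (hKb : K ≤ b * Real.log α) (hc0 : 0 < c) (hc1 : c < 1)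
    (hC : driftConst d (∑ k, |w k|) γ b < (C - 2) * c) (hC0 : 0 < C) :
    ∃ t, Real.log α / lam ≤ t ∧ t ≤ (1 + c) * Real.log α / lam ∧
      regLoss x y lam (θ t) ≤ C * lam * K ∧
      ‖regGrad x y lam (θ t)‖ ^ 2 ≤ 2 * C * b / c * lam ^ 2 := by
  obtain ⟨t₀, ht1, htm, hle⟩ := hθ.exists_loss_le hn hlam hγ0 hγ hK hKlam hα hl hKb hc0 hc1 hC
  set l := Real.log α with hl_def
  have ht00 : 0 ≤ t₀ := le_trans (by positivity) ht1
  have hlt : (1 + c / 2) * l / lam < (1 + c) * l / lam := by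
    gcongr
    linarith
  have h0 : regLoss x y lam (θ t₀) ≤ C * lam * K := by
    have hL := loss_nonneg x y (θ t₀)
    have : loss x y (θ t₀) ≤ K * loss x y (θ t₀) := le_mul_of_one_le_left hL hK
    have : 0 < C * lam * K := by positivity
    rw [regLoss]
    linarith
  have hanti : ∀ t, t₀ ≤ t → regLoss x y lam (θ t) ≤ C * lam * K := fun t ht => by
    have := sub_le_mul_sub_of_hasDerivWithinAt (fun t ht => hθ.hasDerivWithinAt_regLoss ht)
      ht00 ht (C := 0) fun r _ _ => by simp
    linarith
  have hT0 : 0 ≤ (1 + c / 2) * l / lam := by positivity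
  by_contra! hcon
  -- A larger gradient throughout would dissipate `Cλ b log α ≥ CλK` over the remaining length `c
  -- log α / (2λ)`, exhausting the positive regularized loss.
  have h := sub_le_mul_sub_of_hasDerivWithinAt (fun t ht => hθ.hasDerivWithinAt_regLoss ht)
      hT0 hlt.le (C := -(2 * C * b / c * lam ^ 2)) fun r hr hr' => by
    have := hcon r (ht1.trans (htm.trans hr.le)) hr'.le (hanti r (htm.trans hr.le))
    linarith
  have hstart := hanti _ htm
  have e1 : -(2 * C * b / c * lam ^ 2) * ((1 + c) * l / lam - (1 + c / 2) * l / lam) =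
      -(C * lam * (b * l)) := by
    field_simp
    ring
  rw [e1] at h
  have e2 : C * lam * K ≤ C * lam * (b * l) := by gcongr
  have hNpos : 0 < regLoss x y lam (θ ((1 + c) * l / lam)) := by
    have hL : 0 < loss x y (θ ((1 + c) * l / lam)) := by
      rw [loss]
      have : Nonempty (Fin n) := ⟨⟨0, hn⟩⟩
      have : (0 : ℝ) < n := by positivity
      exact mul_pos (by positivity)
        (Finset.sum_pos (fun i _ => Real.exp_pos _) Finset.univ_nonempty)
    rw [regLoss]
    positivity
  linarith

end Flow

/-! ### From approximate stationarity to KKT points. -/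

/-- Margins are 2-homogeneous and all gradients 1-homogeneous, so scaling by `1/√m` normalizes the
minimal margin and preserves stationarity. The multipliers double because the gradient of `‖θ‖²` is
`2θ`. -/
theorem isKKTPoint_inv_sqrt_smul {x : Fin n → EuclideanSpace ℝ (Fin d)} {y : Fin n → ℝ}
    {z : Param d} {m : ℝ} (hm : 0 < m) (hmin : ∀ i, m ≤ y i * net z (x i)) {μ : Fin n → ℝ}
    (hμ : ∀ i, 0 ≤ μ i) (hslack : ∀ i, μ i * (y i * net z (x i) - m) = 0)
    (hstat : z = ∑ i, μ i • y i • netGrad (x i) z) :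
    IsKKTPoint (fun ϑ : Param d => ‖uPart ϑ‖ ^ 2 + ‖vPart ϑ‖ ^ 2)
      (fun (i : Fin n) (ϑ : Param d) => y i * inner ℝ (effWeight ϑ) (x i)) ((√m)⁻¹ • z) := by
  have hs : ((√m)⁻¹) ^ 2 = m⁻¹ := by rw [inv_pow, Real.sq_sqrt hm.le]
  have hq : ∀ i, y i * inner ℝ (effWeight ((√m)⁻¹ • z)) (x i) = m⁻¹ * (y i * net z (x i)) :=
    fun i => by rw [← net_eq_inner, net_smul, hs]; ring
  refine ⟨fun i => ?_, fun i => 2 * μ i, fun i => by linarith [hμ i], fun i => ?_, ?_⟩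
  · simp only [hq]
    rw [le_inv_mul_iff₀ hm, mul_one]
    exact hmin i
  · simp only [hq]
    have : 2 * μ i * (m⁻¹ * (y i * net z (x i)) - 1) =
        2 * m⁻¹ * (μ i * (y i * net z (x i) - m)) := by
      field_simp
    rw [this, hslack, mul_zero]
  · simp only [norm_uPart_sq_add_norm_vPart_sq]
    rw [(hasGradientAt_norm_sq _).gradient]
    simp only [(hasGradientAt_margin _ _ _).gradient]
    conv_lhs => rw [hstat]
    rw [Finset.smul_sum, Finset.smul_sum]
    refine Finset.sum_congr rfl fun i _ => ?_
    rw [netGrad_smul]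
    module

/-- The multipliers read off from the loss gradient. -/
def multiplier (x : Fin n → EuclideanSpace ℝ (Fin d)) (y : Fin n → ℝ) (lam : ℝ) (θ : Param d)
    (i : Fin n) : ℝ :=
  (1 / (n : ℝ)) * Real.exp (-(y i * net θ (x i))) / lam

theorem inv_smul_regGrad (x : Fin n → EuclideanSpace ℝ (Fin d)) (y : Fin n → ℝ) {lam : ℝ}
    (hlam : lam ≠ 0) (θ : Param d) :
    (lam * ‖θ‖)⁻¹ • regGrad x y lam θ = ‖θ‖⁻¹ • θ -
      ∑ i, multiplier x y lam θ i • y i • netGrad (x i) (‖θ‖⁻¹ • θ) := by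
  rw [regGrad, smul_sub, Finset.smul_sum, smul_smul, mul_inv]
  congr 1
  · congr 1
    field_simp
  · refine Finset.sum_congr rfl fun i _ => ?_
    rw [netGrad_smul, multiplier]
    module

/-- Pairing the rescaled gradient with the unit direction gives `1 - 2 ∑ μᵢ qᵢ ≥ -1`, where every
`qᵢ ≥ δ`. -/
theorem multiplier_le {x : Fin n → EuclideanSpace ℝ (Fin d)} {y : Fin n → ℝ} {lam δ : ℝ}
    (hlam : 0 < lam) (hδ : 0 < δ) {θ : Param d} (hθ : θ ≠ 0)
    (hmargin : ∀ i, δ ≤ y i * net (‖θ‖⁻¹ • θ) (x i))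
    (hgrad : ‖(lam * ‖θ‖)⁻¹ • regGrad x y lam θ‖ ≤ 1) (i : Fin n) :
    multiplier x y lam θ i ≤ δ⁻¹ := by
  have hμ : ∀ i, 0 ≤ multiplier x y lam θ i := fun i => by rw [multiplier]; positivity
  set z := ‖θ‖⁻¹ • θ with hz
  have hz1 : ‖z‖ = 1 := norm_smul_inv_norm hθ
  have h1 : inner ℝ ((lam * ‖θ‖)⁻¹ • regGrad x y lam θ) z =
      1 - 2 * ∑ i, multiplier x y lam θ i * (y i * net z (x i)) := by
    rw [inv_smul_regGrad x y hlam.ne', ← hz, inner_sub_left, real_inner_self_eq_norm_sq, hz1,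
      sum_inner, Finset.mul_sum, one_pow]
    congr 1
    refine Finset.sum_congr rfl fun i _ => ?_
    rw [inner_smul_left, inner_smul_left, inner_netGrad_self, conj_trivial, conj_trivial]
    ring
  have h2 := abs_real_inner_le_norm ((lam * ‖θ‖)⁻¹ • regGrad x y lam θ) z
  rw [hz1, mul_one] at h2
  have h2 := (abs_le.1 (h2.trans hgrad)).1
  have h3 : multiplier x y lam θ i * (y i * net z (x i)) ≤
      ∑ i, multiplier x y lam θ i * (y i * net z (x i)) :=
    Finset.single_le_sum (f := fun i => multiplier x y lam θ i * (y i * net z (x i)))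
      (fun i _ => mul_nonneg (hμ i) (hδ.le.trans (hmargin i))) (Finset.mem_univ i)
  have h4 := mul_le_mul_of_nonneg_left (hmargin i) (hμ i)
  rw [← one_div, le_div_iff₀ hδ]
  linarith

theorem le_margin_of_loss_le (hn : 0 < n) {x : Fin n → EuclideanSpace ℝ (Fin d)} {y : Fin n → ℝ}
    {θ : Param d} {q : ℝ} (h : n * loss x y θ ≤ Real.exp (-q)) (i : Fin n) :
    q ≤ y i * net θ (x i) := by
  have hn' : (n : ℝ) ≠ 0 := by positivity
  rw [loss, ← mul_assoc, mul_one_div_cancel hn', one_mul] at h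
  have h1 := (Finset.single_le_sum (f := fun i => Real.exp (-(y i * net θ (x i))))
    (fun i _ => (Real.exp_pos _).le) (Finset.mem_univ i)).trans h
  linarith [Real.exp_le_exp.1 h1]

theorem eventually_mul_mul_exp_neg_le (C : ℝ) :
    ∀ᶠ K : ℝ in atTop, C * (K * Real.exp (-K)) ≤ Real.exp (-(K / 2)) := by
  have h := (Real.tendsto_pow_mul_exp_neg_atTop_nhds_zero 1).comp
    (tendsto_id.atTop_div_const (zero_lt_two (α := ℝ)))
  have h2 := h.const_mul (2 * C)
  rw [mul_zero] at h2
  filter_upwards [h2.eventually_le_const zero_lt_one] with K hK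
  simp only [Function.comp_apply, id, pow_one] at hK
  have e : Real.exp (-K) = Real.exp (-(K / 2)) * Real.exp (-(K / 2)) := by
    rw [← Real.exp_add]; ring_nf
  have := mul_le_mul_of_nonneg_right hK (Real.exp_pos (-(K / 2))).le
  rw [e]
  linarith

/-- Every limiting direction of approximately stationary points with small regularized loss is
the direction of a KKT point of the margin problem. -/
theorem exists_isKKTPoint_of_mapClusterPt (hn : 0 < n) {x : Fin n → EuclideanSpace ℝ (Fin d)}
    {y : Fin n → ℝ} (hy : ∀ i, |y i| = 1) {lam K : ℕ → ℝ} (hKlam : ∀ k, Real.exp (-K k) = lam k)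
    (hK : Tendsto K atTop atTop) {C D : ℝ} (hC : 0 < C) {ϑ : ℕ → Param d}
    (hloss : ∀ᶠ k in atTop, regLoss x y (lam k) (ϑ k) ≤ C * lam k * K k)
    (hgrad : ∀ᶠ k in atTop, ‖regGrad x y (lam k) (ϑ k)‖ ^ 2 ≤ D * lam k ^ 2)
    {z : Param d} (hz : MapClusterPt z atTop fun k => ‖ϑ k‖⁻¹ • ϑ k) :
    ∃ θstar : Param d,
      IsKKTPoint (fun ϑ : Param d => ‖uPart ϑ‖ ^ 2 + ‖vPart ϑ‖ ^ 2)
        (fun (i : Fin n) (ϑ : Param d) => y i * inner ℝ (effWeight ϑ) (x i)) θstar ∧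
      θstar ≠ 0 ∧ z = ‖θstar‖⁻¹ • θstar := by
  have hlam : ∀ k, 0 < lam k := fun k => by rw [← hKlam]; exact Real.exp_pos _
  have hnorm : ∀ᶠ k in atTop, ‖ϑ k‖ ^ 2 ≤ 2 * C * K k := by
    filter_upwards [hloss] with k hk
    have h1 := loss_nonneg x y (ϑ k)
    rw [regLoss] at hk
    have h2 : lam k * ‖ϑ k‖ ^ 2 ≤ lam k * (2 * C * K k) := by linarith
    exact le_of_mul_le_mul_left h2 (hlam k)
  have hmargin : ∀ᶠ k in atTop, ∀ i, K k / 2 ≤ y i * net (ϑ k) (x i) := by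
    filter_upwards [hloss, hK.eventually (eventually_mul_mul_exp_neg_le (n * C))] with k hk hk'
    refine le_margin_of_loss_le hn (le_trans ?_ hk')
    have h1 : 0 ≤ lam k / 2 * ‖ϑ k‖ ^ 2 := mul_nonneg (by linarith [hlam k]) (sq_nonneg _)
    rw [regLoss] at hk
    rw [hKlam]
    have h2 : (n : ℝ) * loss x y (ϑ k) ≤ n * (C * lam k * K k) := by
      gcongr
      linarith
    linarith
  have hN : Tendsto (fun k => ‖ϑ k‖ ^ 2) atTop atTop := by
    have i : Fin n := ⟨0, hn⟩
    have hpos : 0 < 2 * (‖x i‖ + 1) := by positivity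
    refine tendsto_atTop_mono' _ ?_ (hK.atTop_div_const hpos)
    filter_upwards [hmargin] with k hk
    have h1 := abs_net_le (ϑ k) (x i)
    have h2 : y i * net (ϑ k) (x i) ≤ |net (ϑ k) (x i)| := by
      have := le_abs_self (y i * net (ϑ k) (x i))
      rwa [abs_mul, hy, one_mul] at this
    rw [div_le_iff₀ hpos]
    nlinarith [hk i, sq_nonneg ‖ϑ k‖]
  have hNpos : ∀ᶠ k in atTop, 0 < ‖ϑ k‖ ^ 2 := hN.eventually_gt_atTop 0
  have hne : ∀ᶠ k in atTop, ϑ k ≠ 0 := hNpos.mono fun k hk h => by simp [h] at hk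
  have hscale : ∀ k i, y i * net (‖ϑ k‖⁻¹ • ϑ k) (x i) =
      (‖ϑ k‖ ^ 2)⁻¹ * (y i * net (ϑ k) (x i)) := fun k i => by
    rw [net_smul, inv_pow]; ring
  -- Ratio of the margin bound `K/2` to the norm bound `2CK`.
  set δ : ℝ := (4 * C)⁻¹ with hδ
  have hδ0 : 0 < δ := by positivity
  have hδle : ∀ᶠ k in atTop, ∀ i, δ ≤ y i * net (‖ϑ k‖⁻¹ • ϑ k) (x i) := by
    filter_upwards [hmargin, hnorm, hNpos] with k h1 h2 h3 i
    rw [hscale, le_inv_mul_iff₀ h3, hδ, mul_inv_le_iff₀ (by positivity)]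
    nlinarith [h1 i]
  have hres : Tendsto (fun k => (lam k * ‖ϑ k‖)⁻¹ • regGrad x y (lam k) (ϑ k)) atTop (𝓝 0) := by
    rw [tendsto_zero_iff_norm_tendsto_zero]
    have h0 : Tendsto (fun k => D / ‖ϑ k‖ ^ 2) atTop (𝓝 0) := hN.const_div_atTop D
    have h1 : Tendsto (fun k => ‖(lam k * ‖ϑ k‖)⁻¹ • regGrad x y (lam k) (ϑ k)‖ ^ 2) atTop
        (𝓝 0) := by
      refine squeeze_zero' (Eventually.of_forall fun k => sq_nonneg _) ?_ h0
      filter_upwards [hgrad, hNpos] with k h1 h2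
      have h3 : 0 < lam k ^ 2 := pow_pos (hlam k) 2
      rw [norm_smul, mul_pow, norm_inv, norm_mul, norm_norm, inv_pow, mul_pow, Real.norm_eq_abs,
        sq_abs, inv_mul_le_iff₀ (by positivity)]
      have : ‖ϑ k‖ ≠ 0 := fun h => by simp [h] at h2
      refine h1.trans_eq ?_
      field_simp
    have h2 := h1.sqrt
    simpa [Real.sqrt_sq] using h2
  have hμ0 : ∀ k i, 0 ≤ multiplier x y (lam k) (ϑ k) i := fun k i => by
    have := hlam k
    rw [multiplier]
    positivity
  have hμle : ∀ᶠ k in atTop, ∀ i, multiplier x y (lam k) (ϑ k) i ≤ δ⁻¹ := by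
    have h1 := hres.norm
    rw [norm_zero] at h1
    filter_upwards [hδle, hne, h1.eventually_le_const zero_lt_one] with k h1 h2 h3 i
    exact multiplier_le (hlam k) hδ0 h2 h1 h3 i
  obtain ⟨φ, hφ, hφz⟩ := hz.tendsto_subseq
  have hcpt : IsCompact (Set.Icc (0 : Fin n → ℝ) fun _ => δ⁻¹) := isCompact_Icc
  obtain ⟨μ, hμ, ψ, hψ, hψμ⟩ := hcpt.tendsto_subseq'
    (x := fun k => multiplier x y (lam (φ k)) (ϑ (φ k)))
    ((hφ.tendsto_atTop.eventually hμle).mono fun k hk => ⟨hμ0 _, hk⟩).frequently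
  set σ : ℕ → ℕ := φ ∘ ψ with hσ
  have hσt : Tendsto σ atTop atTop := hφ.tendsto_atTop.comp hψ.tendsto_atTop
  have hzσ : Tendsto (fun k => ‖ϑ (σ k)‖⁻¹ • ϑ (σ k)) atTop (𝓝 z) :=
    hφz.comp hψ.tendsto_atTop
  have hμσ : ∀ i, Tendsto (fun k => multiplier x y (lam (σ k)) (ϑ (σ k)) i) atTop (𝓝 (μ i)) :=
    tendsto_pi_nhds.1 hψμ
  have hqσ : ∀ i, Tendsto (fun k => y i * net (‖ϑ (σ k)‖⁻¹ • ϑ (σ k)) (x i)) atTop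
      (𝓝 (y i * net z (x i))) := fun i =>
    (((continuous_net (x i)).tendsto z).comp hzσ).const_mul (y i)
  have hz1 : ‖z‖ = 1 := by
    refine tendsto_nhds_unique hzσ.norm (tendsto_const_nhds.congr' ?_)
    filter_upwards [hσt.eventually hne] with k hk
    exact (norm_smul_inv_norm (𝕜 := ℝ) hk).symm
  have hδz : ∀ i, δ ≤ y i * net z (x i) := fun i =>
    ge_of_tendsto (hqσ i) ((hσt.eventually hδle).mono fun k hk => hk i)
  have hstat : z = ∑ i, μ i • y i • netGrad (x i) z := by
    have h1 := hres.comp hσt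
    have h2 : Tendsto (fun k => ‖ϑ (σ k)‖⁻¹ • ϑ (σ k) - ∑ i, multiplier x y (lam (σ k)) (ϑ (σ k)) i •
        y i • netGrad (x i) (‖ϑ (σ k)‖⁻¹ • ϑ (σ k))) atTop
        (𝓝 (z - ∑ i, μ i • y i • netGrad (x i) z)) :=
      hzσ.sub (tendsto_finsetSum _ fun i _ => (hμσ i).smul
        ((((continuous_netGrad (x i)).tendsto z).comp hzσ).const_smul (y i)))
    refine sub_eq_zero.1 (tendsto_nhds_unique h2 (h1.congr fun k => ?_))
    exact inv_smul_regGrad x y (hlam _).ne' _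
  have : Nonempty (Fin n) := ⟨⟨0, hn⟩⟩
  obtain ⟨j, hj⟩ := Finite.exists_min fun i => y i * net z (x i)
  have hm : 0 < y j * net z (x j) := hδ0.trans_le (hδz j)
  have hslack : ∀ i, μ i * (y i * net z (x i) - y j * net z (x j)) = 0 := fun i => by
    rcases (hj i).eq_or_lt with h | h
    · rw [h, sub_self, mul_zero]
    -- The quotient of multipliers `i` and `j` is the exponential of minus the normalized margin gap
    -- times `‖ϑ‖²`; a strict limiting gap sends it to zero.
    · have h1 : Tendsto (fun k => multiplier x y (lam (σ k)) (ϑ (σ k)) j *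
          Real.exp (-((y i * net (‖ϑ (σ k)‖⁻¹ • ϑ (σ k)) (x i) -
            y j * net (‖ϑ (σ k)‖⁻¹ • ϑ (σ k)) (x j)) * ‖ϑ (σ k)‖ ^ 2))) atTop (𝓝 (μ j * 0)) :=
        (hμσ j).mul (Real.tendsto_exp_neg_atTop_nhds_zero.comp
          (((hqσ i).sub (hqσ j)).pos_mul_atTop (sub_pos.2 h) (hN.comp hσt)))
      rw [mul_zero] at h1
      have h2 : μ i = 0 := by
        refine tendsto_nhds_unique (hμσ i) (h1.congr' ?_)
        filter_upwards [hσt.eventually hNpos] with k hk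
        rw [hscale, hscale, multiplier, multiplier, ← mul_sub, mul_comm (_⁻¹),
          mul_assoc _ (_⁻¹), inv_mul_cancel₀ hk.ne', mul_one, div_mul_eq_mul_div, mul_assoc,
          ← Real.exp_add]
        congr 3
        ring
      rw [h2, zero_mul]
  refine ⟨(√(y j * net z (x j)))⁻¹ • z,
    isKKTPoint_inv_sqrt_smul hm hj (fun i => hμ.1 i) hslack hstat, ?_, ?_⟩
  · refine smul_ne_zero (inv_ne_zero (Real.sqrt_pos.2 hm).ne') fun h => ?_
    rw [h, norm_zero] at hz1
    exact zero_ne_one hz1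
  · have hs := Real.sqrt_pos.2 hm
    rw [norm_smul, hz1, mul_one, Real.norm_of_nonneg (inv_pos.2 hs).le, inv_inv, smul_smul,
      mul_inv_cancel₀ hs.ne', one_smul]

/-! ### Positive margin, size of `log (1/λ)`, and assembly. -/

theorem exists_pos_le_margin {x : Fin n → EuclideanSpace ℝ (Fin d)} {y : Fin n → ℝ}
    (hn : 0 < n) (hy : ∀ i, y i = 1 ∨ y i = -1) {w : EuclideanSpace ℝ (Fin d)}
    (hw : ∀ i, y i = Real.sign (inner ℝ w (x i))) :
    ∃ γ, 0 < γ ∧ ∀ i, γ ≤ y i * inner ℝ w (x i) := by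
  have : Nonempty (Fin n) := ⟨⟨0, hn⟩⟩
  obtain ⟨j, hj⟩ := Finite.exists_min fun i => y i * inner ℝ w (x i)
  refine ⟨_, ?_, hj⟩
  have hne : inner ℝ w (x j) ≠ 0 := fun h => by
    have h1 := hw j
    rw [h, Real.sign_zero] at h1
    rcases hy j with h2 | h2 <;> norm_num [h1] at h2
  rw [hw j]
  exact Real.sign_mul_pos_of_ne_zero _ hne

/-- A weight decay of order `a ^ (-p)` has logarithm of order `-p * log a`. -/
theorem neg_log_of_isTheta_rpow_neg {lam : ℝ → ℝ} (hlam_pos : ∀ a, 0 < a → 0 < lam a)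
    {p : ℝ} (hp : 0 < p) (hlam : lam =Θ[atTop] fun a : ℝ => a ^ (-p)) :
    Tendsto (fun a => -Real.log (lam a)) atTop atTop ∧
      ∃ b, ∀ᶠ a in atTop, -Real.log (lam a) ≤ b * Real.log a := by
  obtain ⟨c₁, hc₁, h₁⟩ := hlam.1.exists_pos
  obtain ⟨c₂, hc₂, h₂⟩ := hlam.2.exists_pos
  constructor
  · refine tendsto_atTop_mono' _ ?_
      (tendsto_atTop_add_const_right _ (-Real.log c₁) (Real.tendsto_log_atTop.const_mul_atTop hp))
    filter_upwards [h₁.bound, eventually_gt_atTop 0] with a ha ha0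
    rw [Real.norm_of_nonneg (hlam_pos a ha0).le, Real.norm_of_nonneg (by positivity)] at ha
    have := Real.log_le_log (hlam_pos a ha0) ha
    rw [Real.log_mul hc₁.ne' (by positivity), Real.log_rpow ha0] at this
    linarith
  -- The additive constant `log c₂` is absorbed into the slope once `log a ≥ 1`.
  · refine ⟨p + |Real.log c₂|, ?_⟩
    filter_upwards [h₂.bound, eventually_gt_atTop 0,
      Real.tendsto_log_atTop.eventually_ge_atTop 1] with a ha ha0 hl
    rw [Real.norm_of_nonneg (hlam_pos a ha0).le, Real.norm_of_nonneg (by positivity)] at ha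
    have := Real.log_le_log (by positivity) ha
    rw [Real.log_mul hc₂.ne' (hlam_pos a ha0).ne', Real.log_rpow ha0] at this
    nlinarith [le_abs_self (Real.log c₂), abs_nonneg (Real.log c₂)]

end DiagNet

end

theorem mainTheorem9 {d n : ℕ} (hn : 0 < n)
    (x : Fin n → EuclideanSpace ℝ (Fin d)) (y : Fin n → ℝ)
    (hy : ∀ i, y i = 1 ∨ y i = -1)
    (wstar : EuclideanSpace ℝ (Fin d)) (hwstar : ∀ i, y i = Real.sign (inner ℝ wstar (x i)))
    (lam : ℝ → ℝ) (hlam_pos : ∀ a, 0 < a → 0 < lam a)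
    (p : ℝ) (hp : 0 < p) (hlam : lam =Θ[atTop] fun a : ℝ => a ^ (-p))
    (c : ℝ) (hc0 : 0 < c) (hc1 : c < 1)
    (α : ℕ → ℝ) (hα1 : ∀ k, 1 ≤ α k) (hα : Tendsto α atTop atTop)
    (θ : ℕ → ℝ → DiagNet.Param d)
    (hθ : ∀ k, DiagNet.IsGradientFlow (DiagNet.regLoss x y (lam (α k)))
      (α k • DiagNet.initParam d) (θ k)) :
    ∃ t : ℕ → ℝ,
      (∀ k, 1 / lam (α k) * Real.log (α k) ≤ t k ∧
        t k ≤ (1 + c) / lam (α k) * Real.log (α k)) ∧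
      ∀ z : DiagNet.Param d,
        MapClusterPt z atTop (fun k => ‖θ k (t k)‖⁻¹ • θ k (t k)) →
        ∃ θstar : DiagNet.Param d,
          DiagNet.IsKKTPoint
            (fun ϑ : DiagNet.Param d => ‖DiagNet.uPart ϑ‖ ^ 2 + ‖DiagNet.vPart ϑ‖ ^ 2)
            (fun (i : Fin n) (ϑ : DiagNet.Param d) =>
              y i * inner ℝ (DiagNet.effWeight ϑ) (x i)) θstar ∧
          θstar ≠ 0 ∧ z = ‖θstar‖⁻¹ • θstar := by

  obtain ⟨γ, hγ0, hγ⟩ := DiagNet.exists_pos_le_margin hn hy hwstar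
  obtain ⟨hKt, b, hb⟩ := DiagNet.neg_log_of_isTheta_rpow_neg hlam_pos hp hlam
  set K : ℕ → ℝ := fun k => -Real.log (lam (α k)) with hK
  have hα0 : ∀ k, 0 < α k := fun k => zero_lt_one.trans_le (hα1 k)
  have hlam0 : ∀ k, 0 < lam (α k) := fun k => hlam_pos _ (hα0 k)
  have hKlam : ∀ k, Real.exp (-K k) = lam (α k) := fun k => by
    rw [hK, neg_neg, Real.exp_log (hlam0 k)]
  set B := DiagNet.driftConst d (∑ k, |wstar k|) γ b with hB
  obtain ⟨C, hC0, hC⟩ : ∃ C : ℝ, 0 < C ∧ B < (C - 2) * c := by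
    refine ⟨(|B| + 1) / c + 2, by positivity, ?_⟩
    rw [add_sub_cancel_right, div_mul_cancel₀ _ hc0.ne']
    linarith [le_abs_self B]
  have hex : ∀ᶠ k in atTop, ∃ t, Real.log (α k) / lam (α k) ≤ t ∧
      t ≤ (1 + c) * Real.log (α k) / lam (α k) ∧
      DiagNet.regLoss x y (lam (α k)) (θ k t) ≤ C * lam (α k) * K k ∧
      ‖DiagNet.regGrad x y (lam (α k)) (θ k t)‖ ^ 2 ≤ 2 * C * b / c * lam (α k) ^ 2 := by
    filter_upwards [hα.eventually hb, hα.eventually (hKt.eventually_ge_atTop 1),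
      hα.eventually (Real.tendsto_log_atTop.eventually_ge_atTop 1)] with k h1 h2 h3
    exact (hθ k).exists_regGrad_le hn (hlam0 k) hγ0 hγ h2 (hKlam k) (hα1 k) h3 h1 hc0 hc1 hC hC0
  -- The time window is required for every `k`, but good times exist only eventually; for other `k`
  -- the left endpoint serves, which does not affect cluster points.
  have hall : ∀ k, ∃ t, (Real.log (α k) / lam (α k) ≤ t ∧
      t ≤ (1 + c) * Real.log (α k) / lam (α k)) ∧
      ((∃ t, Real.log (α k) / lam (α k) ≤ t ∧
        t ≤ (1 + c) * Real.log (α k) / lam (α k) ∧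
        DiagNet.regLoss x y (lam (α k)) (θ k t) ≤ C * lam (α k) * K k ∧
        ‖DiagNet.regGrad x y (lam (α k)) (θ k t)‖ ^ 2 ≤ 2 * C * b / c * lam (α k) ^ 2) →
        DiagNet.regLoss x y (lam (α k)) (θ k t) ≤ C * lam (α k) * K k ∧
        ‖DiagNet.regGrad x y (lam (α k)) (θ k t)‖ ^ 2 ≤ 2 * C * b / c * lam (α k) ^ 2) := by
    intro k
    by_cases h : ∃ t, Real.log (α k) / lam (α k) ≤ t ∧
        t ≤ (1 + c) * Real.log (α k) / lam (α k) ∧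
        DiagNet.regLoss x y (lam (α k)) (θ k t) ≤ C * lam (α k) * K k ∧
        ‖DiagNet.regGrad x y (lam (α k)) (θ k t)‖ ^ 2 ≤ 2 * C * b / c * lam (α k) ^ 2
    · obtain ⟨t, h1, h2, h3⟩ := h
      exact ⟨t, ⟨h1, h2⟩, fun _ => h3⟩
    · refine ⟨Real.log (α k) / lam (α k), ⟨le_rfl, ?_⟩, fun h' => absurd h' h⟩
      have := Real.log_nonneg (hα1 k)
      have := hlam0 k
      gcongr
      nlinarith
  choose t ht hgood using hall
  refine ⟨t, fun k => ?_, fun z hz => ?_⟩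
  · rw [one_div_mul_eq_div, div_mul_eq_mul_div]
    exact ht k
  · exact DiagNet.exists_isKKTPoint_of_mapClusterPt hn
      (fun i => by rcases hy i with h | h <;> simp [h]) hKlam (hKt.comp hα) hC0
      (hex.mono fun k hk => (hgood k hk).1) (hex.mono fun k hk => (hgood k hk).2) hz
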